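/- \textbf{Setting.} Let $1\le d\le k\le p$ and $n\ge 1$ be integers. For $X\in\mathbb R^{n\times p}$ and $J\subseteq[p]=\{1,\dots,p\}$ let $X_J$ be the submatrix of the columns indexed by $J$, $\Psi_{J,J}$ the corresponding principal submatrix of $\Psi\in\mathbb R^{p\times p}$, and $\boldsymbol 1$ the all-ones vector. For a random variable $Z$ put $\|Z\|_{\psi_2}=\sup_{q\ge1}q^{-1/2}(\mathbb E|Z|^q)^{1/q}$, and for a random vector $\|Z\|_{\psi_2}=\sup_{\|u\|_2=1}\|Z^{\sf T}u\|_{\psi_2}$. For a noise vector $\epsilon\in\mathbb R^n$ with covariance matrix $\Sigma=\mathbb E[\epsilon\epsilon^{\sf T}]$ define $$\phi_0=\sup_{\emptyset\ne J\subseteq[p],\,|J|\le k-d+1}\frac{\|\Sigma^{1/2}X_J\boldsymbol 1\|_2^2}{n|J|},\qquad \phi_1=\sup_{J\subseteq[p],\,|J|\le k}\frac{\|\Sigma^{1/2}X_J\|_{\rm op}^2}{n},$$ and, for a numerical constant $b>2$ (the constant of the Hanson--Wright inequality) and $p_0\in(0,1/2)$, $$\phi=\frac1{\sqrt n}\Big(d\phi_0+b\min(d\phi_0,\phi_1)\Big[k\log\tfrac{2epd}{k}+\log\tfrac1{p_0}\Big]\Big)^{1/2}.$$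 \textbf{Assumptions.} $\Psi\in\mathbb R^{p\times p}$ is symmetric positive definite, $\sigma_{\max}(\Psi)\le C_{\max}$, and $$\sup_{\emptyset\ne J\subseteq[p],\,|J|\le k}\frac{1}{|J|}\boldsymbol 1^{\sf T}\Psi_{J,J}\boldsymbol 1\le C_*\le C_{\max}.$$ $X$ is a random $n\times p$ matrix such that the rows of $X\Psi^{-1/2}$ are i.i.d., have mean zero and covariance matrix $I_p$ (so the rows of $X$ have covariance matrix $\Psi$), and have subgaussian norm at most $\kappa$. The noise vector $\epsilon$ has i.i.d. centered Gaussian entries with variance at most $\sigma^2$, where $\sigma\ge0$. \textbf{Lemma.} For every $\kappa\ge 0$ and every $c_0>0$ there are constants $c,C>0$ depending only on $\kappa$ and $c_0$, and for all $b>2$ and $A>0$ a constant $\tilde C>0$ depending only on $\kappa,c_0,b,A$, such that for all $n,p,k,d,C_{\max},C_*,\sigma,\Psi,X,\epsilon$ as above, with probability at least $1-2p^{-ck}-2p^{-c(k-d+1)}$ all of the following hold: (i) if $n\ge c_0(k-d+1)\log p$, then $$\phi_0\le C_*\sigma^2\Big(1+C\sqrt{\tfrac{(k-d+1)\log p}{n}}\Big);$$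 (ii) if $n\ge c_0k\log p$, then $$\phi_1\le C_{\max}\sigma^2\Big(1+C\sqrt{\tfrac{k\log p}{n}}\Big);$$ (iii) if $n\ge c_0k\log p$, then for every $p_0\in(0,1/2)$ with $\log(1/p_0)\le A\,k\log(2epd/k)$, $$\phi\le\tilde C\sigma\Big[\min(dC_*,C_{\max})\,\frac kn\log\Big(\frac{2epd}{k}\Big)\Big]^{1/2}.$$ (Since $k\log(2epd/k)\ge1$, any fixed $p_0\in(0,1/2)$ is covered by $A=\log(1/p_0)$.) -/

import Mathlib

open MeasureTheory ProbabilityTheory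
open scoped ENNReal NNReal Matrix

noncomputable section DesignAggregates

/-- The symmetric positive semidefinite square root `A^{1/2}` of a positive semidefinite matrix,
through the continuous functional calculus of symmetric real matrices. -/
def psdSqrt {m : ℕ} (A : Matrix (Fin m) (Fin m) ℝ) : Matrix (Fin m) (Fin m) ℝ :=
  cfc Real.sqrt A

/-- Spectral norm (largest singular value) of a real matrix: the operator norm of
`v ↦ A v` between Euclidean spaces. -/
def specNorm {ι κ : Type*} [Fintype ι] [Fintype κ] [DecidableEq κ] (A : Matrix ι κ ℝ) : ℝ :=
  ‖LinearMap.toContinuousLinearMap (Matrix.toEuclideanLin A)‖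

/-- `X_J`: the submatrix of `X` formed by the columns in `J`. -/
def colSub {n p : ℕ} (X : Matrix (Fin n) (Fin p) ℝ) (J : Finset (Fin p)) :
    Matrix (Fin n) J ℝ :=
  X.submatrix id (fun a : J => (a : Fin p))

/-- `1ᵀ Ψ_{J,J} 1 / |J|`: normalized sum of the entries of the principal block on `J`. -/
def blockAverage {p : ℕ} (Ψ : Matrix (Fin p) (Fin p) ℝ) (J : Finset (Fin p)) : ℝ :=
  ((1 : J → ℝ) ⬝ᵥ
    (Ψ.submatrix (fun a : J => (a : Fin p)) (fun a : J => (a : Fin p)) *ᵥ (1 : J → ℝ))) /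
      (J.card : ℝ)

/-- `φ₀ = sup ‖Σ^{1/2} X_J 1‖₂² / (n |J|)` over nonempty `J ⊆ [p]` with `|J| ≤ k - d + 1`
(the parameters satisfy `d ≤ k`). `S` is the covariance matrix of the noise. -/
def phiZero {n p : ℕ} (k d : ℕ) (S : Matrix (Fin n) (Fin n) ℝ)
    (X : Matrix (Fin n) (Fin p) ℝ) : ℝ :=
  ⨆ J : {J : Finset (Fin p) // J.Nonempty ∧ J.card ≤ k - d + 1},
    ‖WithLp.toLp 2 ((psdSqrt S * colSub X J.1) *ᵥ (1 : J.1 → ℝ))‖ ^ 2 /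
      ((n : ℝ) * (J.1.card : ℝ))

/-- `φ₁ = sup ‖Σ^{1/2} X_J‖_op² / n` over `J ⊆ [p]` with `|J| ≤ k`. -/
def phiOne {n p : ℕ} (k : ℕ) (S : Matrix (Fin n) (Fin n) ℝ)
    (X : Matrix (Fin n) (Fin p) ℝ) : ℝ :=
  ⨆ J : {J : Finset (Fin p) // J.card ≤ k}, specNorm (psdSqrt S * colSub X J.1) ^ 2 / (n : ℝ)

/-- The regularization level
`φ = n^{-1/2} (d φ₀ + b min(d φ₀, φ₁) [k log(2epd/k) + log(1/p₀)])^{1/2}`,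
where `b` is the numerical constant of the Hanson-Wright inequality. -/
def phiReg {n p : ℕ} (k d : ℕ) (b p₀ : ℝ) (S : Matrix (Fin n) (Fin n) ℝ)
    (X : Matrix (Fin n) (Fin p) ℝ) : ℝ :=
  1 / √(n : ℝ) *
    √((d : ℝ) * phiZero k d S X +
      b * min ((d : ℝ) * phiZero k d S X) (phiOne k S X) *
        ((k : ℝ) * Real.log (2 * Real.exp 1 * p * d / k) + Real.log (1 / p₀)))

/-- The noise covariance matrix `E[ε εᵀ]`. -/
def secondMoment {n : ℕ} {Ω : Type*} [MeasurableSpace Ω] (μ : Measure Ω)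
    (ε : Ω → Fin n → ℝ) : Matrix (Fin n) (Fin n) ℝ :=
  Matrix.of fun i j => ∫ ω, ε ω i * ε ω j ∂μ

/-- Subgaussian norm of a real random variable:
`‖Z‖_{ψ₂} = sup_{q ≥ 1} q^{-1/2} (E|Z|^q)^{1/q}`, with value `∞` when `Z` is not subgaussian. -/
def psiTwoNorm {Ω : Type*} [MeasurableSpace Ω] (μ : Measure Ω) (Z : Ω → ℝ) : ℝ≥0∞ :=
  ⨆ q : {q : ℝ // 1 ≤ q}, eLpNorm Z (ENNReal.ofReal q.1) μ / ENNReal.ofReal √q.1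

/-- Subgaussian norm of a random vector: the supremum of the subgaussian norms of its
one-dimensional projections along Euclidean unit vectors. -/
def psiTwoNormVec {m : ℕ} {Ω : Type*} [MeasurableSpace Ω] (μ : Measure Ω)
    (Z : Ω → Fin m → ℝ) : ℝ≥0∞ :=
  ⨆ u : {u : Fin m → ℝ // u ⬝ᵥ u = 1}, psiTwoNorm μ (fun ω => Z ω ⬝ᵥ u.1)

end DesignAggregates

/-! The noise covariance is `v • 1`, so `φ₀` and `φ₁` are `v ≤ σ²` times suprema of `‖X w‖² /
(n‖u‖²)`, where `w` extends by zero a vector `u` supported on a small `J`: the all-ones vector for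
`φ₀`, an arbitrary nonzero one for `φ₁`. Everything reduces to comparing `‖X w‖²` with `n wᵀΨw`.

For one fixed `w`, `‖X w‖²` is a sum of `n` independent squares of subgaussian variables with total
mean `n wᵀΨw`. Bernstein's inequality bounds the relative error by `C√r` outside probability `2
exp(-8nr)`, as long as `r ≤ 1/c₀` (`exists_sq_concentration`, `exists_design_concentration`). The
choice `nr = a log p` turns this into `2p^(-8a)`, which leaves room for a union bound over at most
`p^(7a)` vectors.

For `φ₀` there are at most `p^(k-d+1)` indicator vectors. For `φ₁` each sparse unit ball is replaced
by a quarter net of at most `25^k` points, and `abs_inner_map_self_le_of_net` extends the estimate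
to the ball at the cost of a factor 4. The bound on `φ` then follows deterministically from the
other two (`phiReg_le`). -/

/-! ### Subgaussian moments and Bernstein's inequality for squares. -/

theorem eLpNorm_le_of_psiTwoNorm_le {Ω : Type*} [MeasurableSpace Ω] {μ : Measure Ω} {Z : Ω → ℝ}
    {κ : ℝ≥0} (h : psiTwoNorm μ Z ≤ κ) {q : ℝ} (hq : 1 ≤ q) :
    eLpNorm Z (ENNReal.ofReal q) μ ≤ κ * ENNReal.ofReal √q := by
  have h1 := (le_iSup (fun q : {q : ℝ // 1 ≤ q} =>
    eLpNorm Z (ENNReal.ofReal q.1) μ / ENNReal.ofReal √q.1) ⟨q, hq⟩).trans h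
  have hpos : 0 < √q := Real.sqrt_pos.2 (by linarith)
  rwa [ENNReal.div_le_iff (by simpa using hpos) ENNReal.ofReal_ne_top] at h1

theorem lintegral_even_pow_le_of_psiTwoNorm_le {Ω : Type*} [MeasurableSpace Ω] {μ : Measure Ω}
    [IsProbabilityMeasure μ] {Z : Ω → ℝ} {κ : ℝ≥0} (h : psiTwoNorm μ Z ≤ κ) (m : ℕ) :
    ∫⁻ ω, ENNReal.ofReal ((Z ω ^ 2) ^ m) ∂μ ≤ ENNReal.ofReal (((κ : ℝ) ^ 2 * (2 * m)) ^ m) := by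
  rcases Nat.eq_zero_or_pos m with rfl | hm
  · simp
  have hm' : (1 : ℝ) ≤ m := by exact_mod_cast hm
  have h1 := eLpNorm_le_of_psiTwoNorm_le h (q := 2 * m) (by linarith)
  have h2 := eLpNorm_nnreal_pow_eq_lintegral (μ := μ) (f := Z) (p := 2 * m)
    (by positivity)
  have e1 : ENNReal.ofReal (2 * m) = ((2 * m : ℝ≥0) : ℝ≥0∞) := by
    rw [ENNReal.ofReal]; congr 1; ext; simp
  have e2 : ((2 * m : ℝ≥0) : ℝ) = ((2 * m : ℕ) : ℝ) := by simp
  rw [e1] at h1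
  rw [e2] at h2
  simp_rw [ENNReal.rpow_natCast] at h2
  have e3 : ∀ ω, ENNReal.ofReal ((Z ω ^ 2) ^ m) = ‖Z ω‖ₑ ^ (2 * m) := by
    intro ω
    rw [← pow_mul, Real.enorm_eq_ofReal_abs, ← ENNReal.ofReal_pow (abs_nonneg _),
      Even.pow_abs (even_two_mul m)]
  simp_rw [e3]
  rw [← h2]
  refine (pow_le_pow_left' h1 _).trans_eq ?_
  rw [← ENNReal.ofReal_coe_nnreal, ← ENNReal.ofReal_mul NNReal.zero_le_coe, ← ENNReal.ofReal_pow (by positivity)]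
  congr 1
  rw [pow_mul, mul_pow, Real.sq_sqrt (by positivity)]

/-- Expanding the exponential, the moment bound `(2mκ²)^m` is beaten by `m!` because `m^m / m! ≤
e^m`; what remains is a geometric series of ratio `1/2`. Lower integrals allow the sum and the
integral to be exchanged freely. -/
theorem lintegral_exp_sq_le_two {Ω : Type*} [MeasurableSpace Ω] {μ : Measure Ω}
    [IsProbabilityMeasure μ] {Z : Ω → ℝ} {κ : ℝ≥0} (hZ : AEMeasurable Z μ)
    (h : psiTwoNorm μ Z ≤ κ) {s : ℝ} (hs : 0 ≤ s)
    (hs' : 2 * Real.exp 1 * (κ : ℝ) ^ 2 * s ≤ 1 / 2) :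
    ∫⁻ ω, ENNReal.ofReal (Real.exp (s * Z ω ^ 2)) ∂μ ≤ 2 := by
  have e1 : ∀ ω, ENNReal.ofReal (Real.exp (s * Z ω ^ 2)) =
      ∑' m : ℕ, ENNReal.ofReal (s ^ m / m.factorial) * ENNReal.ofReal ((Z ω ^ 2) ^ m) := by
    intro ω
    have hsum := NormedSpace.expSeries_div_hasSum_exp (𝔸 := ℝ) (s * Z ω ^ 2)
    rw [← Real.exp_eq_exp_ℝ] at hsum
    rw [← hsum.tsum_eq, ENNReal.ofReal_tsum_of_nonneg (fun m => by positivity) hsum.summable]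
    refine tsum_congr fun m => ?_
    rw [← ENNReal.ofReal_mul (by positivity)]
    congr 1
    rw [mul_pow]; ring
  simp_rw [e1]
  rw [lintegral_tsum fun m => by fun_prop]
  have hgeo : ∑' m : ℕ, ENNReal.ofReal ((1 / 2 : ℝ) ^ m) = 2 := by
    rw [← ENNReal.ofReal_tsum_of_nonneg (fun m => by positivity) summable_geometric_two,
      tsum_geometric_two]
    simp
  rw [← hgeo]
  refine ENNReal.tsum_le_tsum fun m => ?_
  rw [lintegral_const_mul' _ _ ENNReal.ofReal_ne_top]
  refine (mul_le_mul_right (lintegral_even_pow_le_of_psiTwoNorm_le h m) _).trans ?_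
  rw [← ENNReal.ofReal_mul (by positivity)]
  refine ENNReal.ofReal_le_ofReal ?_
  have hfac : (0 : ℝ) < m.factorial := by exact_mod_cast m.factorial_pos
  have hm : (m : ℝ) ^ m / m.factorial ≤ Real.exp 1 ^ m := by
    refine (Real.pow_div_factorial_le_exp (x := m) (by positivity) m).trans_eq ?_
    rw [← Real.exp_nat_mul, mul_one]
  calc s ^ m / m.factorial * ((κ : ℝ) ^ 2 * (2 * m)) ^ m
      = (2 * (κ : ℝ) ^ 2 * s) ^ m * ((m : ℝ) ^ m / m.factorial) := by
        simp only [mul_pow]; ring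
    _ ≤ (2 * (κ : ℝ) ^ 2 * s) ^ m * Real.exp 1 ^ m := by gcongr
    _ = (2 * Real.exp 1 * (κ : ℝ) ^ 2 * s) ^ m := by rw [← mul_pow]; congr 1; ring
    _ ≤ (1 / 2) ^ m := by gcongr

/-- Second-order Taylor estimate for `|x| ≤ 1`; for larger `|x|` the last term is at least `exp |x|`
and dominates. The linear term is kept so that it vanishes when a centred variable is integrated. -/
theorem exp_le_one_add_add_sq_mul_exp_abs (x : ℝ) :
    Real.exp x ≤ 1 + x + x ^ 2 * Real.exp |x| := by
  rcases le_total |x| 1 with h | h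
  · have h1 := Real.abs_exp_sub_one_sub_id_le h
    have h2 := (abs_le.1 h1).2
    have h3 : 1 ≤ Real.exp |x| := Real.one_le_exp (abs_nonneg x)
    nlinarith [sq_nonneg x]
  · have h1 : Real.exp x ≤ Real.exp |x| := Real.exp_le_exp.2 (le_abs_self x)
    rcases le_total 0 x with h0 | h0
    · rw [abs_of_nonneg h0] at *
      have : Real.exp x ≤ x ^ 2 * Real.exp x :=
        le_mul_of_one_le_left (Real.exp_pos x).le (one_le_pow₀ h)
      linarith
    · rw [abs_of_nonpos h0] at *
      have h5 := Real.add_one_le_exp (-x)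
      have h6 : Real.exp x ≤ 1 := Real.exp_le_one_iff.2 h0
      nlinarith [Real.exp_pos (-x)]

/-- The sub-exponential behaviour of the centred square of a subgaussian variable. -/
theorem mgf_sq_sub_one_le {Ω : Type*} [MeasurableSpace Ω] {μ : Measure Ω}
    [IsProbabilityMeasure μ] {Z : Ω → ℝ} (hZ : AEMeasurable Z μ) {s : ℝ} (hs : 0 < s)
    (h2 : ∫ ω, Z ω ^ 2 ∂μ = 1)
    (h : ∫⁻ ω, ENNReal.ofReal (Real.exp (s * Z ω ^ 2)) ∂μ ≤ 2) {t : ℝ} (ht : |t| ≤ s / 2) :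
    Integrable (fun ω => Real.exp (t * (Z ω ^ 2 - 1))) μ ∧
      mgf (fun ω => Z ω ^ 2 - 1) μ t ≤ Real.exp (16 * Real.exp s / s ^ 2 * t ^ 2) := by
  have hI : Integrable (fun ω => Real.exp (s * Z ω ^ 2)) μ := by
    refine ⟨by fun_prop, ?_⟩
    rw [hasFiniteIntegral_iff_ofReal (Filter.Eventually.of_forall fun _ => (Real.exp_pos _).le)]
    exact h.trans_lt (by simp)
  have hE : ∫ ω, Real.exp (s * Z ω ^ 2) ∂μ ≤ 2 := by
    rw [integral_eq_lintegral_of_nonneg_ae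
      (Filter.Eventually.of_forall fun _ => (Real.exp_pos _).le) hI.1]
    exact ENNReal.toReal_le_of_le_ofReal (by norm_num) (by simpa using h)
  -- A non-integrable function has Bochner integral 0 by convention, which contradicts `h2`.
  have hsq : Integrable (fun ω => Z ω ^ 2) μ := by
    by_contra hn
    rw [integral_undef hn] at h2
    norm_num at h2
  -- One factor `exp (s/2 * u)` absorbs `u²`, another bounds the exponential since `|t| ≤ s/2`;
  -- their product is at most `exp s * exp (s Z²)`.
  have key : ∀ ω, Real.exp (t * (Z ω ^ 2 - 1)) ≤ 1 + t * (Z ω ^ 2 - 1) +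
      t ^ 2 * (8 * Real.exp s / s ^ 2) * Real.exp (s * Z ω ^ 2) := by
    intro ω
    refine (exp_le_one_add_add_sq_mul_exp_abs _).trans ?_
    have habs : |Z ω ^ 2 - 1| ≤ Z ω ^ 2 + 1 := by
      rw [abs_le]; constructor <;> nlinarith [sq_nonneg (Z ω)]
    set u := |Z ω ^ 2 - 1| with hu
    have hu0 : 0 ≤ u := abs_nonneg _
    have e1 : (t * (Z ω ^ 2 - 1)) ^ 2 = t ^ 2 * u ^ 2 := by rw [mul_pow, hu, sq_abs]
    have e2 : |t * (Z ω ^ 2 - 1)| ≤ s / 2 * u := by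
      rw [abs_mul]; gcongr
    have e3 : u ^ 2 ≤ 8 / s ^ 2 * Real.exp (s / 2 * u) := by
      have := Real.pow_div_factorial_le_exp (x := s / 2 * u) (by positivity) 2
      rw [div_mul_eq_mul_div, le_div_iff₀ (by positivity)]
      norm_num [Nat.factorial] at this
      nlinarith
    have e4 : Real.exp (s / 2 * u) * Real.exp (s / 2 * u) ≤ Real.exp s * Real.exp (s * Z ω ^ 2) := by
      rw [← Real.exp_add, ← Real.exp_add]
      refine Real.exp_le_exp.2 ?_
      nlinarith
    rw [e1]
    have : t ^ 2 * u ^ 2 * Real.exp |t * (Z ω ^ 2 - 1)| ≤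
        t ^ 2 * (8 / s ^ 2 * Real.exp (s / 2 * u)) * Real.exp (s / 2 * u) := by
      gcongr
    have h5 : t ^ 2 * (8 / s ^ 2 * Real.exp (s / 2 * u)) * Real.exp (s / 2 * u) ≤
        t ^ 2 * (8 / s ^ 2) * (Real.exp s * Real.exp (s * Z ω ^ 2)) := by
      calc _ = t ^ 2 * (8 / s ^ 2) * (Real.exp (s / 2 * u) * Real.exp (s / 2 * u)) := by ring
        _ ≤ _ := by gcongr
    have h6 : t ^ 2 * (8 / s ^ 2) * (Real.exp s * Real.exp (s * Z ω ^ 2)) =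
      t ^ 2 * (8 * Real.exp s / s ^ 2) * Real.exp (s * Z ω ^ 2) := by ring
    linarith
  have hIb : Integrable (fun ω => 1 + t * (Z ω ^ 2 - 1) +
      t ^ 2 * (8 * Real.exp s / s ^ 2) * Real.exp (s * Z ω ^ 2)) μ :=
    ((integrable_const _).add ((hsq.sub (integrable_const _)).const_mul _)).add (hI.const_mul _)
  have hIe : Integrable (fun ω => Real.exp (t * (Z ω ^ 2 - 1))) μ := by
    refine hIb.mono' (by fun_prop) (Filter.Eventually.of_forall fun ω => ?_)
    rw [Real.norm_of_nonneg (Real.exp_pos _).le]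
    exact key ω
  refine ⟨hIe, ?_⟩
  rw [mgf]
  refine (integral_mono hIe hIb key).trans ?_
  have hval : ∫ ω, (1 + t * (Z ω ^ 2 - 1) +
      t ^ 2 * (8 * Real.exp s / s ^ 2) * Real.exp (s * Z ω ^ 2)) ∂μ =
      1 + t ^ 2 * (8 * Real.exp s / s ^ 2) * ∫ ω, Real.exp (s * Z ω ^ 2) ∂μ := by
    have hsq1 : Integrable (fun ω => t * (Z ω ^ 2 - 1)) μ :=
      (hsq.sub (integrable_const _)).const_mul _
    rw [integral_add (by fun_prop) (by fun_prop), integral_add (by fun_prop) (by fun_prop),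
      integral_const_mul, integral_const_mul, integral_sub hsq (integrable_const _), h2]
    simp
  rw [hval]
  have h7 : t ^ 2 * (8 * Real.exp s / s ^ 2) * ∫ ω, Real.exp (s * Z ω ^ 2) ∂μ ≤
      t ^ 2 * (8 * Real.exp s / s ^ 2) * 2 := by gcongr
  have h8 := Real.add_one_le_exp (16 * Real.exp s / s ^ 2 * t ^ 2)
  have h9 : t ^ 2 * (8 * Real.exp s / s ^ 2) * 2 = 16 * Real.exp s / s ^ 2 * t ^ 2 := by ring
  linarith

theorem measureReal_le_sum_le_exp {Ω : Type*} [MeasurableSpace Ω] {μ : Measure Ω}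
    [IsProbabilityMeasure μ] {n : ℕ} {W : Fin n → Ω → ℝ} (hW : ∀ i, AEMeasurable (W i) μ)
    (hind : iIndepFun W μ) {t B : ℝ} (ht : 0 ≤ t)
    (hI : ∀ i, Integrable (fun ω => Real.exp (t * W i ω)) μ)
    (hB : ∀ i, mgf (W i) μ t ≤ Real.exp B) (x : ℝ) :
    μ.real {ω | x ≤ ∑ i, W i ω} ≤ Real.exp (-t * x + n * B) := by
  have hI' : Integrable (fun ω => Real.exp (t * ∑ i, W i ω)) μ := by
    have hae : ∀ i, W i =ᵐ[μ] (hW i).mk (W i) := fun i => (hW i).ae_eq_mk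
    have h1 := (hind.congr hae).integrable_exp_mul_sum (t := t) (s := Finset.univ)
      (fun i => (hW i).measurable_mk) fun i _ => (hI i).congr (by
        filter_upwards [hae i] with ω hω
        rw [hω])
    refine h1.congr ?_
    filter_upwards [ae_all_iff.2 hae] with ω hω
    simp only [Finset.sum_apply, hω]
  refine (measure_ge_le_exp_mul_mgf x ht hI').trans ?_
  have h1 : mgf (fun ω => ∑ i, W i ω) μ t = ∏ i, mgf (W i) μ t := by
    rw [← hind.mgf_sum₀ hW]; congr 1; ext ω; simp
  rw [h1, Real.exp_add]
  gcongr
  calc ∏ i, mgf (W i) μ t ≤ ∏ _i : Fin n, Real.exp B :=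
        Finset.prod_le_prod (fun _ _ => mgf_nonneg) fun i _ => hB i
    _ = Real.exp (n * B) := by rw [Finset.prod_const, Real.exp_nat_mul]; simp

/-- Bernstein's inequality for the empirical second moment of subgaussian variables, at deviation
`C √r` with `r` bounded. -/
theorem exists_sq_concentration (κ : ℝ≥0) (c₀ : ℝ) (hc₀ : 0 < c₀) :
    ∃ C : ℝ, 0 < C ∧ ∀ {Ω : Type*} [MeasurableSpace Ω] (μ : Measure Ω) [IsProbabilityMeasure μ]
      (n : ℕ) (Z : Fin n → Ω → ℝ), (∀ i, AEMeasurable (Z i) μ) → iIndepFun Z μ →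
      (∀ i, ∫ ω, Z i ω ^ 2 ∂μ = 1) → (∀ i, psiTwoNorm μ (Z i) ≤ κ) →
      ∀ r : ℝ, 0 ≤ r → c₀ * r ≤ 1 →
      μ.real {ω | n * (C * √r) ≤ |∑ i, Z i ω ^ 2 - n|} ≤ 2 * Real.exp (-(8 * (n * r))) := by
  obtain ⟨s, hs, hs'⟩ : ∃ s : ℝ, 0 < s ∧ 2 * Real.exp 1 * (κ : ℝ) ^ 2 * s ≤ 1 / 2 := by
    refine ⟨1 / (4 * Real.exp 1 * ((κ : ℝ) ^ 2 + 1)), by positivity, ?_⟩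
    rw [mul_one_div, div_le_div_iff₀ (by positivity) (by norm_num)]
    nlinarith [Real.exp_pos 1]
  set K := 16 * Real.exp s / s ^ 2
  have hK : 0 < K := by positivity
  set a := s / 2 * √c₀ with ha
  have ha0 : 0 < a := by positivity
  -- The Chernoff parameter will be `l = a√r`, admissible because `c₀ r ≤ 1` gives `l ≤ s/2`. The
  -- exponent is then `-nr(aC - K a²)`, and `C` is solved for to make it `-8nr`.
  refine ⟨(8 + K * a ^ 2) / a, by positivity, ?_⟩
  intro Ω _ μ _ n Z hZ hind h2 hψ r hr hr'
  set C := (8 + K * a ^ 2) / a with hC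
  have haC : a * C = 8 + K * a ^ 2 := by rw [hC]; field_simp
  have hrs : √c₀ * √r ≤ 1 := by
    rw [← Real.sqrt_mul hc₀.le]; exact Real.sqrt_le_one.2 hr'
  set l := a * √r with hl
  have hl0 : 0 ≤ l := by positivity
  have hls : l ≤ s / 2 := by
    rw [hl, ha, mul_assoc]; nlinarith
  have hM := fun i => lintegral_exp_sq_le_two (hZ i) (hψ i) hs.le hs'
  have hp := fun i => mgf_sq_sub_one_le (hZ i) hs (h2 i) (hM i) (t := l) (by rwa [abs_of_nonneg hl0])
  have hm := fun i => mgf_sq_sub_one_le (hZ i) hs (h2 i) (hM i) (t := -l)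
    (by rwa [abs_neg, abs_of_nonneg hl0])
  have hexp : -l * (n * (C * √r)) + n * (K * l ^ 2) = -(8 * (n * r)) := by
    have hsr : √r * √r = r := Real.mul_self_sqrt hr
    have : -l * (n * (C * √r)) + n * (K * l ^ 2) = -(n * (√r * √r) * (a * C - K * a ^ 2)) := by
      rw [hl]; ring
    rw [this, haC, hsr]; ring
  have hup := measureReal_le_sum_le_exp (μ := μ) (W := fun i ω => Z i ω ^ 2 - 1)
    (fun i => by have := hZ i; fun_prop)
    (hind.comp (fun _ y => y ^ 2 - 1) fun _ => by fun_prop) hl0 (fun i => (hp i).1)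
    (fun i => (hp i).2) (n * (C * √r))
  have hlo := measureReal_le_sum_le_exp (μ := μ) (W := fun i ω => -(Z i ω ^ 2 - 1))
    (fun i => by have := hZ i; fun_prop)
    (hind.comp (fun _ y => -(y ^ 2 - 1)) fun _ => by fun_prop) hl0
    (fun i => by simpa only [neg_mul, mul_neg] using (hm i).1)
    (fun i => by
      have := (hm i).2
      rw [neg_sq] at this
      rw [show (fun ω => -(Z i ω ^ 2 - 1)) = -(fun ω => Z i ω ^ 2 - 1) from rfl, mgf_neg]
      exact this) (n * (C * √r))
  rw [hexp] at hup hlo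
  have hsub : {ω | n * (C * √r) ≤ |∑ i, Z i ω ^ 2 - n|} ⊆
      {ω | n * (C * √r) ≤ ∑ i, (Z i ω ^ 2 - 1)} ∪ {ω | n * (C * √r) ≤ ∑ i, -(Z i ω ^ 2 - 1)} := by
    intro ω hω
    simp only [Set.mem_union, Set.mem_ofPred_eq, Finset.sum_neg_distrib, Finset.sum_sub_distrib,
      Finset.sum_const, Finset.card_univ, Fintype.card_fin, nsmul_eq_mul, mul_one] at hω ⊢
    exact le_abs.1 hω
  refine (measureReal_mono hsub).trans ((measureReal_union_le _ _).trans ?_)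
  linarith

/-! ### Nets of Euclidean balls and quadratic forms on them. -/

/-- A 1-separated subset of the ball of maximal cardinality is a net, and the Besicovitch packing
bound limits its size. -/
theorem exists_finset_net_ball_two (E : Type*) [NormedAddCommGroup E] [NormedSpace ℝ E]
    [FiniteDimensional ℝ E] :
    ∃ T : Finset E, T.card ≤ 5 ^ Module.finrank ℝ E ∧
      ∀ u : E, ‖u‖ ≤ 2 → ∃ x ∈ T, ‖u - x‖ ≤ 1 := by
  classical
  set P : ℕ → Prop := fun m => ∃ s : Finset E, s.card = m ∧ (∀ c ∈ s, ‖c‖ ≤ 2) ∧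
    ∀ c ∈ s, ∀ d ∈ s, c ≠ d → 1 ≤ ‖c - d‖ with hP
  have hbound : ∀ m, P m → m ≤ 5 ^ Module.finrank ℝ E := by
    rintro m ⟨s, rfl, h1, h2⟩
    exact Besicovitch.card_le_of_separated s h1 h2
  have h0 : P 0 := ⟨∅, by simp⟩
  obtain ⟨T, hT, h1, h2⟩ := Nat.findGreatest_spec (P := P) (Nat.zero_le _) h0
  refine ⟨T, hT ▸ Nat.findGreatest_le _, fun u hu => ?_⟩
  by_contra! hcon
  have huT : u ∉ T := fun h => by simpa using (hcon u h).trans' one_pos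
  have hins : P (T.card + 1) := by
    refine ⟨insert u T, Finset.card_insert_of_notMem huT, ?_, ?_⟩
    · simpa [hu] using h1
    · intro c hc d hd hcd
      rw [Finset.mem_insert] at hc hd
      rcases hc with rfl | hc <;> rcases hd with rfl | hd
      · exact absurd rfl hcd
      · exact (hcon d hd).le
      · rw [norm_sub_rev]; exact (hcon c hc).le
      · exact h2 c hc d hd hcd
  have := Nat.le_findGreatest (hbound _ hins) hins
  omega

/-- Two rounds of successive approximation: double the vector, approximate to within 1, double the
residual and approximate again. Each round contributes a factor `5^dim`. -/
theorem exists_finset_quarter_net (E : Type*) [NormedAddCommGroup E] [NormedSpace ℝ E]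
    [FiniteDimensional ℝ E] :
    ∃ N : Finset E, N.card ≤ 25 ^ Module.finrank ℝ E ∧
      ∀ u : E, ‖u‖ ≤ 1 → ∃ x ∈ N, ‖u - x‖ ≤ 1 / 4 := by
  classical
  obtain ⟨T, hT, hnet⟩ := exists_finset_net_ball_two E
  refine ⟨(T ×ˢ T).image fun z => (1 / 2 : ℝ) • z.1 + (1 / 4 : ℝ) • z.2, ?_, fun u hu => ?_⟩
  · refine Finset.card_image_le.trans ?_
    rw [Finset.card_product, show 25 = 5 * 5 by norm_num, mul_pow]
    gcongr
  · obtain ⟨x, hx, hux⟩ := hnet ((2 : ℝ) • u) (by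
      rw [norm_smul, Real.norm_of_nonneg zero_le_two]; linarith)
    obtain ⟨y, hy, huy⟩ := hnet ((2 : ℝ) • ((2 : ℝ) • u - x)) (by
      rw [norm_smul, Real.norm_of_nonneg zero_le_two]; linarith)
    refine ⟨_, Finset.mem_image_of_mem _ (Finset.mk_mem_product hx hy), ?_⟩
    have : u - ((1 / 2 : ℝ) • x + (1 / 4 : ℝ) • y) =
        (1 / 4 : ℝ) • ((2 : ℝ) • ((2 : ℝ) • u - x) - y) := by module
    rw [this, norm_smul, Real.norm_of_nonneg (by norm_num)]
    linarith

/-- A quadratic form that is small on a quarter net of the unit ball is small everywhere. -/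
theorem abs_inner_map_self_le_of_net {E : Type*} [NormedAddCommGroup E] [InnerProductSpace ℝ E]
    [FiniteDimensional ℝ E] (A : E →ₗ[ℝ] E) (N : Set E)
    (hN : ∀ u : E, ‖u‖ ≤ 1 → ∃ x ∈ N, ‖u - x‖ ≤ 1 / 4) {δ : ℝ}
    (h : ∀ x ∈ N, |inner ℝ (A x) x| ≤ δ * ‖x‖ ^ 2) (hδ : 0 ≤ δ) (u : E) :
    |inner ℝ (A u) u| ≤ 4 * δ * ‖u‖ ^ 2 := by
  have hA : Continuous A := A.continuous_of_finiteDimensional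
  have hcont : Continuous fun v : E => |inner ℝ (A v) v| := by fun_prop
  obtain ⟨u₀, hu₀, hmax⟩ := (isCompact_closedBall (0 : E) 1).exists_isMaxOn
    ⟨0, Metric.mem_closedBall_self zero_le_one⟩ hcont.continuousOn
  rw [mem_closedBall_zero_iff] at hu₀
  set S := |inner ℝ (A u₀) u₀| with hS
  have hS0 : 0 ≤ S := abs_nonneg _
  have hle : ∀ v : E, |inner ℝ (A v) v| ≤ S * ‖v‖ ^ 2 := by
    intro v
    rcases eq_or_ne v 0 with rfl | hv
    · simp
    have hv' : 0 < ‖v‖ := norm_pos_iff.2 hv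
    have h1 : |inner ℝ (A (‖v‖⁻¹ • v)) (‖v‖⁻¹ • v)| ≤ S := hmax (by
      rw [mem_closedBall_zero_iff, norm_smul, norm_inv, norm_norm, inv_mul_cancel₀ hv'.ne'])
    rw [map_smul, real_inner_smul_left, real_inner_smul_right, abs_mul, abs_mul,
      abs_of_pos (inv_pos.2 hv')] at h1
    calc |inner ℝ (A v) v| = ‖v‖⁻¹ * (‖v‖⁻¹ * |inner ℝ (A v) v|) * ‖v‖ ^ 2 := by field_simp
      _ ≤ S * ‖v‖ ^ 2 := by gcongr
  suffices hSδ : S ≤ 4 * δ by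
    exact (hle u).trans (by gcongr)
  obtain ⟨x, hx, hux⟩ := hN u₀ hu₀
  -- Polarization with weights 3 and 1/3 gives both vectors norm at most 3/4, so the difference of
  -- forms is at most `9/16 * S`. With `25/16 * δ` at `x`, this yields `S ≤ 25/7 * δ`.
  set a := (3 : ℝ) • (u₀ - x)
  set b := (1 / 3 : ℝ) • (u₀ + x)
  have hx1 : ‖x‖ ≤ 5 / 4 := by
    have := norm_sub_norm_le x u₀
    rw [norm_sub_rev] at this
    linarith
  have ha : ‖a‖ ≤ 3 / 4 := by
    rw [norm_smul, Real.norm_of_nonneg (by norm_num)]; linarith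
  have hb : ‖b‖ ≤ 3 / 4 := by
    have := norm_add_le u₀ x
    rw [norm_smul, Real.norm_of_nonneg (by norm_num)]; linarith
  have hpol : inner ℝ (A u₀) u₀ - inner ℝ (A x) x =
      (inner ℝ (A (a + b)) (a + b) - inner ℝ (A (a - b)) (a - b)) / 4 := by
    simp only [a, b, map_add, map_sub, map_smul, inner_add_left, inner_add_right, inner_sub_left,
      inner_sub_right, real_inner_smul_left, real_inner_smul_right]
    ring
  have hpar := parallelogram_law_with_norm ℝ a b
  have h1 := abs_le.1 (hle (a + b))
  have h2 := abs_le.1 (hle (a - b))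
  have h3 : |inner ℝ (A u₀) u₀ - inner ℝ (A x) x| ≤ 9 / 16 * S := by
    have hsum : S * ‖a + b‖ ^ 2 + S * ‖a - b‖ ^ 2 ≤ 9 / 4 * S := by
      have : ‖a + b‖ ^ 2 + ‖a - b‖ ^ 2 ≤ 9 / 4 := by
        nlinarith [norm_nonneg a, norm_nonneg b]
      nlinarith
    rw [hpol, abs_le]
    constructor <;> linarith [h1.1, h1.2, h2.1, h2.2]
  have h4 : |inner ℝ (A x) x| ≤ 25 / 16 * δ := (h x hx).trans (by
    have : ‖x‖ ^ 2 ≤ 25 / 16 := by nlinarith [norm_nonneg x]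
    nlinarith)
  have h5 := abs_sub_abs_le_abs_sub (inner ℝ (A u₀) u₀) (inner ℝ (A x) x)
  linarith

/-! ### Matrix square roots and second moments. -/

theorem psdSqrt_mul_self {m : ℕ} {A : Matrix (Fin m) (Fin m) ℝ} (hA : A.PosSemidef) :
    psdSqrt A * psdSqrt A = A := by
  have hsa : IsSelfAdjoint A := hA.isHermitian
  rw [psdSqrt, ← cfc_mul _ _ A]
  have : cfc (fun x => √x * √x) A = cfc (fun x : ℝ => x) A := by
    refine cfc_congr fun x hx => ?_
    rw [hA.isHermitian.spectrum_real_eq_range_eigenvalues] at hx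
    obtain ⟨i, rfl⟩ := hx
    exact Real.mul_self_sqrt (hA.eigenvalues_nonneg i)
  rw [this, cfc_id' ℝ A hsa]

theorem transpose_psdSqrt {m : ℕ} (A : Matrix (Fin m) (Fin m) ℝ) :
    (psdSqrt A)ᵀ = psdSqrt A := by
  have h : IsSelfAdjoint (psdSqrt A) := cfc_predicate Real.sqrt A
  rw [← Matrix.conjTranspose_eq_transpose_of_trivial]
  exact h

theorem psdSqrt_smul_one {m : ℕ} (v : ℝ) :
    psdSqrt (v • (1 : Matrix (Fin m) (Fin m) ℝ)) = √v • (1 : Matrix (Fin m) (Fin m) ℝ) := by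
  rw [psdSqrt, ← Algebra.algebraMap_eq_smul_one, cfc_algebraMap, Algebra.algebraMap_eq_smul_one]

theorem dotProduct_mulVec_eq_psdSqrt {m : ℕ} {A : Matrix (Fin m) (Fin m) ℝ} (hA : A.PosSemidef)
    (w : Fin m → ℝ) : w ⬝ᵥ A *ᵥ w = (psdSqrt A *ᵥ w) ⬝ᵥ (psdSqrt A *ᵥ w) := by
  conv_lhs => rw [← psdSqrt_mul_self hA]
  rw [← Matrix.mulVec_mulVec, Matrix.dotProduct_mulVec]
  congr 1
  rw [← Matrix.mulVec_transpose, transpose_psdSqrt]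

theorem secondMoment_of_iIndepFun_gaussianReal {n : ℕ} {Ω : Type*} [MeasurableSpace Ω]
    {μ : Measure Ω} {ε : Ω → Fin n → ℝ} {v : ℝ≥0}
    (hind : iIndepFun (fun (i : Fin n) (ω : Ω) => ε ω i) μ)
    (hlaw : ∀ i : Fin n, HasLaw (fun ω => ε ω i) (gaussianReal 0 v) μ) :
    secondMoment μ ε = (v : ℝ) • (1 : Matrix (Fin n) (Fin n) ℝ) := by
  have hmean : ∀ i, ∫ ω, ε ω i ∂μ = 0 := fun i => by
    rw [(hlaw i).integral_eq, integral_id_gaussianReal]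
  ext i j
  rw [secondMoment, Matrix.of_apply, Matrix.smul_apply, Matrix.one_apply]
  split_ifs with hij
  · subst hij
    have h1 := variance_of_integral_eq_zero (hlaw i).aemeasurable (hmean i)
    rw [(hlaw i).variance_eq, variance_id_gaussianReal] at h1
    simp_rw [← pow_two]
    rw [← h1]; simp
  · rw [(hind.indepFun hij).integral_fun_mul_eq_mul_integral
      (hlaw i).aemeasurable.aestronglyMeasurable (hlaw j).aemeasurable.aestronglyMeasurable,
      hmean i]
    simp

theorem integral_dotProduct_sq_of_isotropic {p : ℕ} {Ω : Type*} [MeasurableSpace Ω]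
    {μ : Measure Ω} {Z : Ω → Fin p → ℝ} (hZ : AEMeasurable Z μ)
    (hcov : ∀ a a' : Fin p, ∫ ω, Z ω a * Z ω a' ∂μ = if a = a' then 1 else 0) (u : Fin p → ℝ) :
    ∫ ω, (Z ω ⬝ᵥ u) ^ 2 ∂μ = u ⬝ᵥ u := by
  have hZa : ∀ a, AEMeasurable (fun ω => Z ω a) μ := fun a => (measurable_pi_apply a).comp_aemeasurable hZ
  have hL : ∀ a, MemLp (fun ω => Z ω a) 2 μ := by
    intro a
    rw [memLp_two_iff_integrable_sq (hZa a).aestronglyMeasurable]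
    by_contra hn
    have := hcov a a
    simp_rw [← pow_two] at this
    rw [integral_undef hn] at this
    simp at this
  have hI : ∀ a a', Integrable (fun ω => Z ω a * Z ω a') μ := fun a a' => (hL a).integrable_mul (hL a')
  have e : ∀ ω, (Z ω ⬝ᵥ u) ^ 2 = ∑ a, ∑ a', (u a * u a') * (Z ω a * Z ω a') := by
    intro ω
    rw [pow_two, dotProduct, Finset.sum_mul_sum]
    exact Finset.sum_congr rfl fun a _ => Finset.sum_congr rfl fun a' _ => by ring
  simp_rw [e]
  rw [integral_finsetSum _ fun a _ => integrable_finsetSum _ fun a' _ => (hI a a').const_mul _]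
  refine Finset.sum_congr rfl fun a _ => ?_
  rw [integral_finsetSum _ fun a' _ => (hI a a').const_mul _]
  simp_rw [integral_const_mul, hcov]
  simp

/-! ### Concentration of `‖X w‖²` for a fixed vector. -/

/-- Both sides are homogeneous of degree 2 in `g`, so the unit case suffices. The strict inequality
makes the bad event empty for `g = 0`. -/
theorem exists_isotropic_concentration (κ : ℝ≥0) (c₀ : ℝ) (hc₀ : 0 < c₀) :
    ∃ C : ℝ, 0 < C ∧ ∀ {Ω : Type*} [MeasurableSpace Ω] (μ : Measure Ω) [IsProbabilityMeasure μ]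
      (n p : ℕ) (Z : Ω → Matrix (Fin n) (Fin p) ℝ),
      (∀ i, AEMeasurable (fun ω => Z ω i) μ) → iIndepFun (fun (i : Fin n) ω => Z ω i) μ →
      (∀ (i : Fin n) (a a' : Fin p), ∫ ω, Z ω i a * Z ω i a' ∂μ = if a = a' then 1 else 0) →
      (∀ i : Fin n, psiTwoNormVec μ (fun ω => Z ω i) ≤ κ) →
      ∀ r : ℝ, 0 ≤ r → c₀ * r ≤ 1 → ∀ g : Fin p → ℝ,
      μ.real {ω | n * (C * √r) * (g ⬝ᵥ g) < |∑ i, (Z ω i ⬝ᵥ g) ^ 2 - n * (g ⬝ᵥ g)|} ≤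
        2 * Real.exp (-(8 * (n * r))) := by
  obtain ⟨C, hC, h⟩ := exists_sq_concentration κ c₀ hc₀
  refine ⟨C, hC, ?_⟩
  intro Ω _ μ _ n p Z hZ hind hcov hψ r hr hr' g
  rcases eq_or_ne g 0 with rfl | hg
  · simp; positivity
  have hq : 0 < g ⬝ᵥ g := lt_of_le_of_ne (Finset.sum_nonneg fun _ _ => mul_self_nonneg _)
    (Ne.symm (by rwa [Ne, dotProduct_self_eq_zero]))
  set q := g ⬝ᵥ g with hqdef
  have hsq : √q ^ 2 = q := Real.sq_sqrt hq.le
  have hsqpos : 0 < √q := Real.sqrt_pos.2 hq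
  set u : Fin p → ℝ := (√q)⁻¹ • g with hu
  have huu : u ⬝ᵥ u = 1 := by
    rw [hu, smul_dotProduct, dotProduct_smul, ← hqdef, smul_eq_mul, smul_eq_mul]
    field_simp
    exact hsq.symm
  have hgu : g = √q • u := by rw [hu, smul_smul, mul_inv_cancel₀ hsqpos.ne', one_smul]
  have hmeas : Measurable fun z : Fin p → ℝ => z ⬝ᵥ u := by
    unfold dotProduct; fun_prop
  have key := h μ n (fun i ω => Z ω i ⬝ᵥ u) (fun i => hmeas.comp_aemeasurable (hZ i))
    (hind.comp (fun _ z => z ⬝ᵥ u) fun _ => hmeas)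
    (fun i => by rw [integral_dotProduct_sq_of_isotropic (hZ i) (hcov i), huu])
    (fun i => (le_iSup (fun u : {u : Fin p → ℝ // u ⬝ᵥ u = 1} =>
      psiTwoNorm μ (fun ω => Z ω i ⬝ᵥ u.1)) ⟨u, huu⟩).trans (hψ i)) r hr hr'
  refine (measureReal_mono ?_).trans key
  intro ω hω
  rw [Set.mem_ofPred_eq] at hω ⊢
  have e : ∑ i, (Z ω i ⬝ᵥ g) ^ 2 - n * q = (∑ i, (Z ω i ⬝ᵥ u) ^ 2 - n) * q := by
    conv_lhs => rw [hgu]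
    simp_rw [dotProduct_smul, smul_eq_mul, mul_pow, hsq]
    rw [← Finset.mul_sum]; ring
  rw [e, abs_mul, abs_of_pos hq] at hω
  exact (lt_of_mul_lt_mul_right hω hq.le).le

/-- The isotropic case applied to `g = Ψ^{1/2} w`, since `X w = (X Ψ^{-1/2}) g` and `‖g‖² = wᵀΨw`.
-/
theorem exists_design_concentration (κ : ℝ≥0) (c₀ : ℝ) (hc₀ : 0 < c₀) :
    ∃ C : ℝ, 0 < C ∧ ∀ {Ω : Type*} [MeasurableSpace Ω] (μ : Measure Ω) [IsProbabilityMeasure μ]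
      (n p : ℕ) (Ψ : Matrix (Fin p) (Fin p) ℝ), Ψ.PosDef → ∀ (X : Ω → Matrix (Fin n) (Fin p) ℝ),
      (∀ i, AEMeasurable (fun ω => (X ω * (psdSqrt Ψ)⁻¹) i) μ) →
      iIndepFun (fun (i : Fin n) ω => (X ω * (psdSqrt Ψ)⁻¹) i) μ →
      (∀ (i : Fin n) (a a' : Fin p), ∫ ω, (X ω * (psdSqrt Ψ)⁻¹) i a *
        (X ω * (psdSqrt Ψ)⁻¹) i a' ∂μ = if a = a' then 1 else 0) →
      (∀ i : Fin n, psiTwoNormVec μ (fun ω => (X ω * (psdSqrt Ψ)⁻¹) i) ≤ κ) →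
      ∀ r : ℝ, 0 ≤ r → c₀ * r ≤ 1 → ∀ w : Fin p → ℝ,
      μ.real {ω | n * (C * √r) * (w ⬝ᵥ Ψ *ᵥ w) <
          |(X ω *ᵥ w) ⬝ᵥ (X ω *ᵥ w) - n * (w ⬝ᵥ Ψ *ᵥ w)|} ≤
        2 * Real.exp (-(8 * (n * r))) := by
  obtain ⟨C, hC, h⟩ := exists_isotropic_concentration κ c₀ hc₀
  refine ⟨C, hC, ?_⟩
  intro Ω _ μ _ n p Ψ hΨ X hX hind hcov hψ r hr hr' w
  have key := h μ n p (fun ω => X ω * (psdSqrt Ψ)⁻¹) hX hind hcov hψ r hr hr' (psdSqrt Ψ *ᵥ w)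
  have hdet : IsUnit (psdSqrt Ψ).det := by
    have h1 : (psdSqrt Ψ).det * (psdSqrt Ψ).det = Ψ.det := by
      rw [← Matrix.det_mul, psdSqrt_mul_self hΨ.posSemidef]
    rw [isUnit_iff_ne_zero]
    intro h0
    rw [h0, mul_zero] at h1
    exact hΨ.det_pos.ne h1
  rw [dotProduct_mulVec_eq_psdSqrt hΨ.posSemidef]
  have e : ∀ ω, (X ω *ᵥ w) ⬝ᵥ (X ω *ᵥ w) =
      ∑ i, ((X ω * (psdSqrt Ψ)⁻¹) i ⬝ᵥ (psdSqrt Ψ *ᵥ w)) ^ 2 := by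
    intro ω
    have h1 : X ω *ᵥ w = (X ω * (psdSqrt Ψ)⁻¹) *ᵥ (psdSqrt Ψ *ᵥ w) := by
      rw [Matrix.mulVec_mulVec, Matrix.nonsing_inv_mul_cancel_right _ _ hdet]
    rw [h1, dotProduct]
    exact Finset.sum_congr rfl fun i _ => (pow_two _).symm
  simp_rw [e]
  exact key

/-! ### Column selection, spectral norms and deterministic bounds on `φ₀`, `φ₁`. -/

/-- The selector `colSub 1 J` extends vectors on `J` by zero, so statements about `X_J u` become
statements about `X w` with `w` in the full space. -/
theorem colSub_eq_mul {n p : ℕ} (X : Matrix (Fin n) (Fin p) ℝ) (J : Finset (Fin p)) :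
    colSub X J = X * colSub (1 : Matrix (Fin p) (Fin p) ℝ) J := by
  rw [colSub, colSub]
  conv_lhs => rw [← Matrix.mul_one X]
  rw [Matrix.submatrix_mul X 1 id id _ Function.bijective_id, Matrix.submatrix_id_id]

theorem transpose_colSub_one_mul_self {p : ℕ} (J : Finset (Fin p)) :
    (colSub (1 : Matrix (Fin p) (Fin p) ℝ) J)ᵀ * colSub (1 : Matrix (Fin p) (Fin p) ℝ) J = 1 := by
  rw [colSub, Matrix.transpose_submatrix, Matrix.transpose_one,
    ← Matrix.submatrix_mul _ _ _ _ _ Function.bijective_id, Matrix.one_mul]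
  exact Matrix.submatrix_one _ Subtype.val_injective

theorem colSub_one_mulVec_dotProduct_self {p : ℕ} (J : Finset (Fin p)) (u : J → ℝ) :
    (colSub (1 : Matrix (Fin p) (Fin p) ℝ) J *ᵥ u) ⬝ᵥ
      (colSub (1 : Matrix (Fin p) (Fin p) ℝ) J *ᵥ u) = u ⬝ᵥ u := by
  rw [Matrix.dotProduct_mulVec, ← Matrix.mulVec_transpose, Matrix.mulVec_mulVec,
    transpose_colSub_one_mul_self, Matrix.one_mulVec]

theorem blockAverage_eq {p : ℕ} (Ψ : Matrix (Fin p) (Fin p) ℝ) (J : Finset (Fin p)) :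
    blockAverage Ψ J = ((colSub (1 : Matrix (Fin p) (Fin p) ℝ) J *ᵥ 1) ⬝ᵥ
      Ψ *ᵥ (colSub (1 : Matrix (Fin p) (Fin p) ℝ) J *ᵥ 1)) / (J.card : ℝ) := by
  rw [blockAverage]
  congr 1
  have h1 : Ψ.submatrix (fun a : J => (a : Fin p)) (fun a : J => (a : Fin p)) =
      (colSub (1 : Matrix (Fin p) (Fin p) ℝ) J)ᵀ * Ψ * colSub (1 : Matrix (Fin p) (Fin p) ℝ) J := by
    rw [colSub, Matrix.transpose_submatrix, Matrix.transpose_one]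
    conv_rhs => rw [← Matrix.submatrix_id_id Ψ]
    rw [← Matrix.submatrix_mul _ _ _ _ _ Function.bijective_id,
      ← Matrix.submatrix_mul _ _ _ _ _ Function.bijective_id, Matrix.one_mul, Matrix.mul_one]
  rw [h1, ← Matrix.mulVec_mulVec, ← Matrix.mulVec_mulVec, Matrix.mulVec_transpose,
    dotProduct_comm, ← Matrix.dotProduct_mulVec, dotProduct_comm]

theorem norm_toLp_sq {ι : Type*} [Fintype ι] (x : ι → ℝ) : ‖WithLp.toLp 2 x‖ ^ 2 = x ⬝ᵥ x := by
  rw [EuclideanSpace.real_norm_sq_eq, dotProduct]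
  exact Finset.sum_congr rfl fun i _ => pow_two _

theorem norm_toEuclideanLin_le_specNorm {ι κ : Type*} [Fintype ι] [Fintype κ] [DecidableEq κ]
    (A : Matrix ι κ ℝ) (x : EuclideanSpace ℝ κ) :
    ‖Matrix.toEuclideanLin A x‖ ≤ specNorm A * ‖x‖ :=
  (LinearMap.toContinuousLinearMap (Matrix.toEuclideanLin A)).le_opNorm x

theorem dotProduct_mulVec_le_specNorm {m : ℕ} (A : Matrix (Fin m) (Fin m) ℝ) (w : Fin m → ℝ) :
    w ⬝ᵥ A *ᵥ w ≤ specNorm A * (w ⬝ᵥ w) := by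
  have h1 := real_inner_le_norm (Matrix.toEuclideanLin A (WithLp.toLp 2 w)) (WithLp.toLp 2 w)
  have h2 := norm_toEuclideanLin_le_specNorm A (WithLp.toLp 2 w)
  have h3 : inner ℝ (Matrix.toEuclideanLin A (WithLp.toLp 2 w)) (WithLp.toLp 2 w) =
      w ⬝ᵥ A *ᵥ w := by
    rw [EuclideanSpace.inner_eq_star_dotProduct, Matrix.toLpLin_apply]; simp
  rw [h3] at h1
  rw [← norm_toLp_sq]
  calc _ ≤ _ := h1
    _ ≤ specNorm A * ‖WithLp.toLp 2 w‖ * ‖WithLp.toLp 2 w‖ := by gcongr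
    _ = _ := by ring

theorem specNorm_sq_le {ι κ : Type*} [Fintype ι] [Fintype κ] [DecidableEq κ]
    (A : Matrix ι κ ℝ) {B : ℝ} (hB : 0 ≤ B)
    (h : ∀ u : κ → ℝ, (A *ᵥ u) ⬝ᵥ (A *ᵥ u) ≤ B * (u ⬝ᵥ u)) : specNorm A ^ 2 ≤ B := by
  have h1 : specNorm A ≤ √B := by
    refine ContinuousLinearMap.opNorm_le_bound _ (Real.sqrt_nonneg B) fun x => ?_
    have h2 := h x.ofLp
    rw [← norm_toLp_sq, ← norm_toLp_sq] at h2
    rw [← Real.sqrt_sq (norm_nonneg x), ← Real.sqrt_mul hB]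
    exact Real.le_sqrt_of_sq_le h2
  calc specNorm A ^ 2 ≤ √B ^ 2 := by gcongr; exact norm_nonneg _
    _ = B := Real.sq_sqrt hB

theorem scaled_mulVec_dotProduct {n p : ℕ} (v : ℝ≥0) (X : Matrix (Fin n) (Fin p) ℝ)
    (J : Finset (Fin p)) (u : J → ℝ) :
    ((psdSqrt ((v : ℝ) • (1 : Matrix (Fin n) (Fin n) ℝ)) * colSub X J) *ᵥ u) ⬝ᵥ
      ((psdSqrt ((v : ℝ) • (1 : Matrix (Fin n) (Fin n) ℝ)) * colSub X J) *ᵥ u) =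
    v * ((X *ᵥ (colSub (1 : Matrix (Fin p) (Fin p) ℝ) J *ᵥ u)) ⬝ᵥ
      (X *ᵥ (colSub (1 : Matrix (Fin p) (Fin p) ℝ) J *ᵥ u))) := by
  rw [psdSqrt_smul_one, Matrix.smul_mul, Matrix.one_mul, Matrix.smul_mulVec, colSub_eq_mul X,
    ← Matrix.mulVec_mulVec, smul_dotProduct, dotProduct_smul, smul_eq_mul, smul_eq_mul, ← mul_assoc,
    Real.mul_self_sqrt NNReal.zero_le_coe]

/-- `φ₀` for homoscedastic noise, from the concentration of `‖X 1_J‖²`. -/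
theorem phiZero_smul_one_le {n p k d : ℕ} (hn : 1 ≤ n) {v : ℝ≥0} {Cstar σ δ : ℝ}
    (hC : 0 ≤ Cstar) (hδ : 0 ≤ δ) (hv : (v : ℝ) ≤ σ ^ 2) {Ψ : Matrix (Fin p) (Fin p) ℝ}
    (hblock : ∀ J : Finset (Fin p), J.Nonempty → J.card ≤ k - d + 1 → blockAverage Ψ J ≤ Cstar)
    {X : Matrix (Fin n) (Fin p) ℝ}
    (hX : ∀ J : Finset (Fin p), J.Nonempty → J.card ≤ k - d + 1 → ∀ w : Fin p → ℝ,
      w = colSub (1 : Matrix (Fin p) (Fin p) ℝ) J *ᵥ 1 →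
      |(X *ᵥ w) ⬝ᵥ (X *ᵥ w) - n * (w ⬝ᵥ Ψ *ᵥ w)| ≤ n * δ * (w ⬝ᵥ Ψ *ᵥ w)) :
    phiZero k d ((v : ℝ) • (1 : Matrix (Fin n) (Fin n) ℝ)) X ≤ Cstar * σ ^ 2 * (1 + δ) := by
  -- The bound must be nonnegative because a real supremum over an empty family is 0.
  refine Real.iSup_le (fun J => ?_) (by positivity)
  have hn' : (0 : ℝ) < n := by exact_mod_cast hn
  have hJ : (0 : ℝ) < J.1.card := by exact_mod_cast J.2.1.card_pos
  rw [norm_toLp_sq, scaled_mulVec_dotProduct]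
  have h1 := (abs_le.1 (hX J.1 J.2.1 J.2.2 _ rfl)).2
  have h2 := hblock J.1 J.2.1 J.2.2
  rw [blockAverage_eq, div_le_iff₀ hJ] at h2
  set w := colSub (1 : Matrix (Fin p) (Fin p) ℝ) J.1 *ᵥ 1
  rw [div_le_iff₀ (by positivity)]
  have h3 : (X *ᵥ w) ⬝ᵥ (X *ᵥ w) ≤ n * (1 + δ) * (Cstar * J.1.card) := by
    calc (X *ᵥ w) ⬝ᵥ (X *ᵥ w) ≤ n * (1 + δ) * (w ⬝ᵥ Ψ *ᵥ w) := by linarith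
      _ ≤ _ := by gcongr
  calc (v : ℝ) * ((X *ᵥ w) ⬝ᵥ (X *ᵥ w)) ≤ v * (n * (1 + δ) * (Cstar * J.1.card)) := by gcongr
    _ ≤ σ ^ 2 * (n * (1 + δ) * (Cstar * J.1.card)) := by gcongr
    _ = _ := by ring

/-- `φ₁` for homoscedastic noise, from the concentration of `‖X x‖²` along quarter nets of the
sparse unit balls. -/
theorem phiOne_smul_one_le {n p k : ℕ} (hn : 1 ≤ n) {v : ℝ≥0} {Cmax σ δ : ℝ}
    (hC : 0 ≤ Cmax) (hδ : 0 ≤ δ) (hv : (v : ℝ) ≤ σ ^ 2) {Ψ : Matrix (Fin p) (Fin p) ℝ}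
    (hΨ : specNorm Ψ ≤ Cmax) (N : ∀ J : Finset (Fin p), Finset (EuclideanSpace ℝ J))
    (hN : ∀ J : Finset (Fin p), ∀ u : EuclideanSpace ℝ J, ‖u‖ ≤ 1 → ∃ x ∈ N J, ‖u - x‖ ≤ 1 / 4)
    {X : Matrix (Fin n) (Fin p) ℝ}
    (hX : ∀ J : Finset (Fin p), J.card ≤ k → ∀ x ∈ N J, ∀ w : Fin p → ℝ,
      w = colSub (1 : Matrix (Fin p) (Fin p) ℝ) J *ᵥ x.ofLp →
      |(X *ᵥ w) ⬝ᵥ (X *ᵥ w) - n * (w ⬝ᵥ Ψ *ᵥ w)| ≤ n * δ * (w ⬝ᵥ Ψ *ᵥ w)) :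
    phiOne k ((v : ℝ) • (1 : Matrix (Fin n) (Fin n) ℝ)) X ≤ Cmax * σ ^ 2 * (1 + 4 * δ) := by
  refine Real.iSup_le (fun J => ?_) (by positivity)
  have hn' : (0 : ℝ) < n := by exact_mod_cast hn
  rw [div_le_iff₀ hn']
  refine specNorm_sq_le _ (by positivity) fun u => ?_
  rw [scaled_mulVec_dotProduct]
  set I := colSub (1 : Matrix (Fin p) (Fin p) ℝ) J.1 with hI
  have hquad : ∀ u : J.1 → ℝ, (I *ᵥ u) ⬝ᵥ Ψ *ᵥ (I *ᵥ u) ≤ Cmax * (u ⬝ᵥ u) := by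
    intro u
    refine (dotProduct_mulVec_le_specNorm Ψ _).trans ?_
    rw [colSub_one_mulVec_dotProduct_self]
    have : 0 ≤ u ⬝ᵥ u := by rw [← norm_toLp_sq]; positivity
    gcongr
  -- The quadratic form of this compression is the deviation of `‖X w‖²` from `n wᵀΨw`. The relative
  -- error on the net becomes absolute through `wᵀΨw ≤ Cmax ‖u‖²`.
  set A := Matrix.toEuclideanLin (Iᵀ * (Xᵀ * X - (n : ℝ) • Ψ) * I) with hA
  have hinner : ∀ x : EuclideanSpace ℝ J.1, inner ℝ (A x) x =
      (X *ᵥ (I *ᵥ x.ofLp)) ⬝ᵥ (X *ᵥ (I *ᵥ x.ofLp)) -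
        n * ((I *ᵥ x.ofLp) ⬝ᵥ Ψ *ᵥ (I *ᵥ x.ofLp)) := by
    intro x
    rw [EuclideanSpace.inner_eq_star_dotProduct, hA, Matrix.toLpLin_apply, star_trivial,
      ← Matrix.mulVec_mulVec, ← Matrix.mulVec_mulVec, Matrix.mulVec_transpose, dotProduct_comm,
      ← Matrix.dotProduct_mulVec, Matrix.sub_mulVec, sub_dotProduct, Matrix.smul_mulVec,
      smul_dotProduct, smul_eq_mul, ← Matrix.mulVec_mulVec, Matrix.mulVec_transpose,
      ← Matrix.dotProduct_mulVec, dotProduct_comm (Ψ *ᵥ _)]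
  have hnet := abs_inner_map_self_le_of_net A (N J.1 : Set (EuclideanSpace ℝ J.1)) (hN J.1)
    (δ := n * δ * Cmax) (fun x hx => by
      rw [hinner]
      refine (hX J.1 J.2 x hx _ rfl).trans ?_
      rw [mul_assoc (n * δ)]
      gcongr
      have : ‖x‖ ^ 2 = x.ofLp ⬝ᵥ x.ofLp := norm_toLp_sq x.ofLp
      rw [this]
      exact hquad _) (by positivity) (WithLp.toLp 2 u)
  rw [hinner, norm_toLp_sq] at hnet
  have h1 := (abs_le.1 hnet).2
  have h2 := hquad u
  have huu : 0 ≤ u ⬝ᵥ u := by rw [← norm_toLp_sq]; positivity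
  have h3 : (X *ᵥ (I *ᵥ u)) ⬝ᵥ (X *ᵥ (I *ᵥ u)) ≤ n * Cmax * (1 + 4 * δ) * (u ⬝ᵥ u) := by
    have : n * ((I *ᵥ u) ⬝ᵥ Ψ *ᵥ (I *ᵥ u)) ≤ n * (Cmax * (u ⬝ᵥ u)) := by gcongr
    simp only at h1
    linarith
  calc (v : ℝ) * ((X *ᵥ (I *ᵥ u)) ⬝ᵥ (X *ᵥ (I *ᵥ u)))
      ≤ v * (n * Cmax * (1 + 4 * δ) * (u ⬝ᵥ u)) := by gcongr
    _ ≤ σ ^ 2 * (n * Cmax * (1 + 4 * δ) * (u ⬝ᵥ u)) := by gcongr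
    _ = _ := by ring

/-! ### Union bounds over supports and nets. -/

/-- Each such `J` is the image of a map `Fin m → Fin p`: enumerate `J` and pad with one of its
elements, hence the nonemptiness. -/
theorem card_nonempty_card_le {p m : ℕ} :
    (Finset.univ.filter fun J : Finset (Fin p) => J.Nonempty ∧ J.card ≤ m).card ≤ p ^ m := by
  classical
  have hsub : (Finset.univ.filter fun J : Finset (Fin p) => J.Nonempty ∧ J.card ≤ m) ⊆
      Finset.univ.image fun f : Fin m → Fin p => Finset.univ.image f := by
    intro J hJ
    obtain ⟨⟨x, hx⟩, hcard⟩ := (Finset.mem_filter.1 hJ).2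
    have e := J.equivFin
    refine Finset.mem_image.2 ⟨fun i => if h : (i : ℕ) < J.card then (e.symm ⟨i, h⟩ : Fin p) else x,
      Finset.mem_univ _, ?_⟩
    ext y
    simp only [Finset.mem_image, Finset.mem_univ, true_and]
    constructor
    · rintro ⟨i, rfl⟩
      split_ifs
      · exact Subtype.prop _
      · exact hx
    · intro hy
      refine ⟨⟨e ⟨y, hy⟩, (e ⟨y, hy⟩).2.trans_le hcard⟩, ?_⟩
      simp
  refine (Finset.card_le_card hsub).trans (Finset.card_image_le.trans ?_)
  simp

theorem measureReal_biUnion_le_of_card_le {Ω ι : Type*} [MeasurableSpace Ω] {μ : Measure Ω}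
    [IsProbabilityMeasure μ] (s : Finset ι) (B : ι → Set Ω) {L : ℝ}
    (hcard : (s.card : ℝ) ≤ Real.exp (7 * L))
    (hB : ∀ i ∈ s, μ.real (B i) ≤ 2 * Real.exp (-(8 * L))) :
    μ.real (⋃ i ∈ s, B i) ≤ 2 * Real.exp (-L) := by
  refine (measureReal_biUnion_finset_le s B).trans ((Finset.sum_le_card_nsmul s _ _ hB).trans ?_)
  rw [nsmul_eq_mul]
  calc (s.card : ℝ) * (2 * Real.exp (-(8 * L))) ≤ Real.exp (7 * L) * (2 * Real.exp (-(8 * L))) := by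
        gcongr
    _ = 2 * Real.exp (-L) := by
        rw [mul_left_comm, ← Real.exp_add]; ring_nf

/-- The exceptional set need not be measurable: only monotonicity and subadditivity of the measure
are used. -/
theorem exists_event_phiZero_le {n p k d : ℕ} (hn : 1 ≤ n) {v : ℝ≥0} {Cstar σ δ L : ℝ}
    (hC : 0 ≤ Cstar) (hδ : 0 ≤ δ) (hv : (v : ℝ) ≤ σ ^ 2) {Ψ : Matrix (Fin p) (Fin p) ℝ}
    (hblock : ∀ J : Finset (Fin p), J.Nonempty → J.card ≤ k - d + 1 → blockAverage Ψ J ≤ Cstar)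
    {Ω : Type*} [MeasurableSpace Ω] {μ : Measure Ω} [IsProbabilityMeasure μ]
    {X : Ω → Matrix (Fin n) (Fin p) ℝ}
    (hX : ∀ w : Fin p → ℝ, μ.real {ω | n * δ * (w ⬝ᵥ Ψ *ᵥ w) <
      |(X ω *ᵥ w) ⬝ᵥ (X ω *ᵥ w) - n * (w ⬝ᵥ Ψ *ᵥ w)|} ≤ 2 * Real.exp (-(8 * L)))
    (hL : 0 ≤ L) (hpL : (p : ℝ) ^ (k - d + 1) ≤ Real.exp L) :
    ∃ B : Set Ω, μ.real B ≤ 2 * Real.exp (-L) ∧ ∀ ω ∉ B,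
      phiZero k d ((v : ℝ) • (1 : Matrix (Fin n) (Fin n) ℝ)) (X ω) ≤
        Cstar * σ ^ 2 * (1 + δ) := by
  classical
  set F := Finset.univ.filter fun J : Finset (Fin p) => J.Nonempty ∧ J.card ≤ k - d + 1 with hF
  refine ⟨⋃ J ∈ F, {ω | ∃ w : Fin p → ℝ, w = colSub (1 : Matrix (Fin p) (Fin p) ℝ) J *ᵥ 1 ∧
    n * δ * (w ⬝ᵥ Ψ *ᵥ w) < |(X ω *ᵥ w) ⬝ᵥ (X ω *ᵥ w) - n * (w ⬝ᵥ Ψ *ᵥ w)|},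
    measureReal_biUnion_le_of_card_le _ _ ?_ ?_, fun ω hω => ?_⟩
  · have h1 : (F.card : ℝ) ≤ (p : ℝ) ^ (k - d + 1) := by exact_mod_cast card_nonempty_card_le
    exact (h1.trans hpL).trans (Real.exp_le_exp.2 (by linarith))
  · intro J _
    simpa only [exists_eq_left] using hX (colSub (1 : Matrix (Fin p) (Fin p) ℝ) J *ᵥ 1)
  · refine phiZero_smul_one_le hn hC hδ hv hblock fun J hJ hJc w hw => ?_
    by_contra! hcon
    exact hω (Set.mem_biUnion (Finset.mem_filter.2 ⟨Finset.mem_univ _, hJ, hJc⟩) ⟨w, hw, hcon⟩)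

theorem exists_event_phiOne_le {n p k : ℕ} (hn : 1 ≤ n) {v : ℝ≥0} {Cmax σ δ L : ℝ}
    (hδ : 0 ≤ δ) (hv : (v : ℝ) ≤ σ ^ 2) {Ψ : Matrix (Fin p) (Fin p) ℝ}
    (hΨ : specNorm Ψ ≤ Cmax)
    {Ω : Type*} [MeasurableSpace Ω] {μ : Measure Ω} [IsProbabilityMeasure μ]
    {X : Ω → Matrix (Fin n) (Fin p) ℝ}
    (hX : ∀ w : Fin p → ℝ, μ.real {ω | n * δ * (w ⬝ᵥ Ψ *ᵥ w) <
      |(X ω *ᵥ w) ⬝ᵥ (X ω *ᵥ w) - n * (w ⬝ᵥ Ψ *ᵥ w)|} ≤ 2 * Real.exp (-(8 * L)))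
    (hp : 2 ≤ p) (hpL : (p : ℝ) ^ k ≤ Real.exp L) :
    ∃ B : Set Ω, μ.real B ≤ 2 * Real.exp (-L) ∧ ∀ ω ∉ B,
      phiOne k ((v : ℝ) • (1 : Matrix (Fin n) (Fin n) ℝ)) (X ω) ≤
        Cmax * σ ^ 2 * (1 + 4 * δ) := by
  classical
  choose N hNcard hN using fun J : Finset (Fin p) => exists_finset_quarter_net (EuclideanSpace ℝ J)
  set F := Finset.univ.filter fun J : Finset (Fin p) => J.Nonempty ∧ J.card ≤ k with hF
  have hp' : (1 : ℝ) ≤ p := by exact_mod_cast (by omega : 1 ≤ p)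
  have hL : 0 ≤ L := by
    have : 1 ≤ Real.exp L := (one_le_pow₀ hp').trans hpL
    exact Real.one_le_exp_iff.1 this
  refine ⟨⋃ z ∈ F.sigma N, {ω | ∃ w : Fin p → ℝ,
    w = colSub (1 : Matrix (Fin p) (Fin p) ℝ) z.1 *ᵥ z.2.ofLp ∧
    n * δ * (w ⬝ᵥ Ψ *ᵥ w) < |(X ω *ᵥ w) ⬝ᵥ (X ω *ᵥ w) - n * (w ⬝ᵥ Ψ *ᵥ w)|},
    measureReal_biUnion_le_of_card_le _ _ ?_ ?_, fun ω hω => ?_⟩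
  · have h1 : (F.sigma N).card ≤ p ^ k * 25 ^ k := by
      rw [Finset.card_sigma]
      calc ∑ J ∈ F, (N J).card ≤ ∑ _J ∈ F, 25 ^ k := by
            refine Finset.sum_le_sum fun J hJ => (hNcard J).trans ?_
            rw [finrank_euclideanSpace, Fintype.card_coe]
            exact Nat.pow_le_pow_right (by norm_num) (Finset.mem_filter.1 hJ).2.2
        _ = F.card * 25 ^ k := by rw [Finset.sum_const, smul_eq_mul]
        _ ≤ p ^ k * 25 ^ k := by
            gcongr
            exact card_nonempty_card_le
    have h2 : p ^ k * 25 ^ k ≤ (p ^ k) ^ 6 := by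
      -- For `p ≥ 2` the net size is itself a power of `p^k`, so the whole union has at most
      -- `p^(6k)` members.
      have h25 : 25 ≤ p ^ 5 := (by norm_num : 25 ≤ 2 ^ 5).trans (Nat.pow_le_pow_left hp 5)
      calc p ^ k * 25 ^ k ≤ p ^ k * (p ^ 5) ^ k := by gcongr
        _ = (p ^ k) ^ 6 := by ring
    calc ((F.sigma N).card : ℝ) ≤ ((p : ℝ) ^ k) ^ 6 := by exact_mod_cast h1.trans h2
      _ ≤ Real.exp L ^ 6 := by gcongr
      _ = Real.exp (6 * L) := by rw [← Real.exp_nat_mul]; norm_num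
      _ ≤ Real.exp (7 * L) := Real.exp_le_exp.2 (by linarith)
  · intro z _
    simpa only [exists_eq_left] using
      hX (colSub (1 : Matrix (Fin p) (Fin p) ℝ) z.1 *ᵥ z.2.ofLp)
  · refine phiOne_smul_one_le hn ((norm_nonneg _).trans hΨ) hδ hv hΨ N hN
      fun J hJ x hx w hw => ?_
    -- The empty support is outside the union, but there `w = 0` and the estimate is trivial.
    rcases J.eq_empty_or_nonempty with rfl | hne
    · have : w = 0 := by
        rw [hw]; ext a; simp [Matrix.mulVec, dotProduct]
      simp [this]
    by_contra! hcon
    exact hω (Set.mem_biUnion (x := (⟨J, x⟩ : Σ J : Finset (Fin p), EuclideanSpace ℝ J))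
      (Finset.mem_sigma.2 ⟨Finset.mem_filter.2 ⟨Finset.mem_univ _, hne, hJ⟩, hx⟩) ⟨w, hw, hcon⟩)

/-! ### The regularization level and the conclusion. -/

theorem blockAverage_nonneg {p : ℕ} {Ψ : Matrix (Fin p) (Fin p) ℝ}
    (hΨ : Ψ.PosSemidef) (J : Finset (Fin p)) : 0 ≤ blockAverage Ψ J := by
  rw [blockAverage_eq]
  have := hΨ.dotProduct_mulVec_nonneg (colSub (1 : Matrix (Fin p) (Fin p) ℝ) J *ᵥ 1)
  rw [star_trivial] at this
  positivity

/-- The regularization level is controlled by the bounds on `φ₀` and `φ₁`. -/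
theorem phiReg_le {n p k d : ℕ} (hd : 1 ≤ d) (hdk : d ≤ k) (hkp : k ≤ p)
    {S : Matrix (Fin n) (Fin n) ℝ} {X : Matrix (Fin n) (Fin p) ℝ} {b A M p₀ Cstar Cmax σ : ℝ}
    (hb : 0 ≤ b) (hA : 0 ≤ A) (hM : 0 ≤ M) (hσ : 0 ≤ σ) (hC0 : 0 ≤ Cstar) (hC : Cstar ≤ Cmax)
    (h0 : phiZero k d S X ≤ Cstar * σ ^ 2 * M) (h1 : phiOne k S X ≤ Cmax * σ ^ 2 * M)
    (hp₀ : 0 < p₀) (hp₁ : p₀ < 1 / 2)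
    (hp₂ : Real.log (1 / p₀) ≤ A * ((k : ℝ) * Real.log (2 * Real.exp 1 * p * d / k))) :
    phiReg k d b p₀ S X ≤ √(M * (1 + b * (1 + A))) * σ *
      √(min ((d : ℝ) * Cstar) Cmax * ((k : ℝ) / n) * Real.log (2 * Real.exp 1 * p * d / k)) := by
  have hd' : (1 : ℝ) ≤ d := by exact_mod_cast hd
  have hdk' : (d : ℝ) ≤ k := by exact_mod_cast hdk
  have hkp' : (k : ℝ) ≤ p := by exact_mod_cast hkp
  have hk0 : (0 : ℝ) < k := by linarith
  have hp0 : (0 : ℝ) < p := by linarith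
  have hlog : 1 ≤ Real.log (2 * Real.exp 1 * p * d / k) := by
    rw [Real.le_log_iff_exp_le (by positivity), le_div_iff₀ hk0]
    have he := Real.exp_pos 1
    calc Real.exp 1 * k ≤ Real.exp 1 * (p * d) := by gcongr; nlinarith
      _ ≤ 2 * Real.exp 1 * p * d := by
        have : 0 ≤ Real.exp 1 * (p * d) := by positivity
        linarith
  set ℓ := Real.log (2 * Real.exp 1 * p * d / k)
  have hl0 : 0 ≤ Real.log (1 / p₀) := Real.log_nonneg (by
    rw [le_div_iff₀ hp₀]; linarith)
  set m := min ((d : ℝ) * Cstar) Cmax with hm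
  have hm0 : 0 ≤ m := le_min (by positivity) (hC0.trans hC)
  have hkl : (k : ℝ) ≤ k * ℓ := le_mul_of_one_le_right hk0.le hlog
  have hkl1 : (1 : ℝ) ≤ k * ℓ := by linarith
  -- The term `d φ₀` carries no minimum; it is absorbed because `kℓ ≥ 1` in one case, and because
  -- `Cstar ≤ Cmax` and `d ≤ k ≤ kℓ` in the other.
  have hdC : d * Cstar ≤ m * (k * ℓ) := by
    rcases min_choice ((d : ℝ) * Cstar) Cmax with h | h
    · rw [hm, h]
      exact le_mul_of_one_le_right (by positivity) hkl1
    · rw [hm, h, mul_comm Cmax]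
      have : 0 ≤ Cmax := hC0.trans hC
      gcongr
      linarith
  have hsM : 0 ≤ σ ^ 2 * M := by positivity
  have hfirst : d * phiZero k d S X ≤ σ ^ 2 * M * (m * (k * ℓ)) := by
    calc d * phiZero k d S X ≤ d * (Cstar * σ ^ 2 * M) := by gcongr
      _ = σ ^ 2 * M * (d * Cstar) := by ring
      _ ≤ _ := by gcongr
  have hmin : min (d * phiZero k d S X) (phiOne k S X) ≤ σ ^ 2 * M * m := by
    rw [hm, mul_min_of_nonneg _ _ hsM]
    refine min_le_min ?_ (h1.trans_eq (by ring))
    calc d * phiZero k d S X ≤ d * (Cstar * σ ^ 2 * M) := by gcongr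
      _ = σ ^ 2 * M * (d * Cstar) := by ring
  have hE : d * phiZero k d S X + b * min (d * phiZero k d S X) (phiOne k S X) *
      (k * ℓ + Real.log (1 / p₀)) ≤ M * (1 + b * (1 + A)) * σ ^ 2 * (m * (k * ℓ)) := by
    have h2 : b * min (d * phiZero k d S X) (phiOne k S X) * (k * ℓ + Real.log (1 / p₀)) ≤
        b * (σ ^ 2 * M * m) * ((1 + A) * (k * ℓ)) := by
      calc _ ≤ b * (σ ^ 2 * M * m) * (k * ℓ + Real.log (1 / p₀)) := by gcongr
        _ ≤ _ := by gcongr; linarith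
    calc _ ≤ _ := add_le_add hfirst h2
      _ = _ := by ring
  calc phiReg k d b p₀ S X ≤ 1 / √(n : ℝ) * √(M * (1 + b * (1 + A)) * σ ^ 2 * (m * (k * ℓ))) := by
        rw [phiReg]; gcongr
    _ = √(M * (1 + b * (1 + A))) * σ * (√(m * (k * ℓ)) / √(n : ℝ)) := by
        rw [Real.sqrt_mul (by positivity), Real.sqrt_mul (by positivity), Real.sqrt_sq hσ]; ring
    _ = _ := by
        rw [← Real.sqrt_div (by positivity)]
        congr 2
        ring

theorem mainTheorem9 (κ : ℝ≥0) (c₀ : ℝ) (hc₀ : 0 < c₀) :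
    ∃ c C : ℝ, 0 < c ∧ 0 < C ∧
    ∀ b A : ℝ, 2 < b → 0 < A →
    ∃ C' : ℝ, 0 < C' ∧
    ∀ (n p k d : ℕ), 1 ≤ n → 1 ≤ d → d ≤ k → k ≤ p →
    ∀ (Cmax Cstar σ : ℝ), Cstar ≤ Cmax → 0 ≤ σ →
    -- the population matrix
    ∀ (Ψ : Matrix (Fin p) (Fin p) ℝ), Ψ.PosDef →
      specNorm Ψ ≤ Cmax →
      (∀ J : Finset (Fin p), J.Nonempty → J.card ≤ k → blockAverage Ψ J ≤ Cstar) →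
    ∀ (Ω : Type*) [MeasurableSpace Ω] (μ : Measure Ω) [IsProbabilityMeasure μ]
      (X : Ω → Matrix (Fin n) (Fin p) ℝ) (ε : Ω → Fin n → ℝ) (v : ℝ≥0),
      -- the rows of `X Ψ^{-1/2}` are i.i.d., centered, isotropic and subgaussian
      iIndepFun (fun (i : Fin n) (ω : Ω) => (X ω * (psdSqrt Ψ)⁻¹) i) μ →
      (∀ i j : Fin n, IdentDistrib (fun ω => (X ω * (psdSqrt Ψ)⁻¹) i)
        (fun ω => (X ω * (psdSqrt Ψ)⁻¹) j) μ μ) →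
      (∀ (i : Fin n) (a : Fin p), ∫ ω, (X ω * (psdSqrt Ψ)⁻¹) i a ∂μ = 0) →
      (∀ (i : Fin n) (a a' : Fin p), ∫ ω, (X ω * (psdSqrt Ψ)⁻¹) i a *
        (X ω * (psdSqrt Ψ)⁻¹) i a' ∂μ = if a = a' then 1 else 0) →
      (∀ i : Fin n, psiTwoNormVec μ (fun ω => (X ω * (psdSqrt Ψ)⁻¹) i) ≤ (κ : ℝ≥0∞)) →
      -- the noise has i.i.d. centered Gaussian entries of variance `v ≤ σ²`
      iIndepFun (fun (i : Fin n) (ω : Ω) => ε ω i) μ →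
      (∀ i : Fin n, HasLaw (fun ω => ε ω i) (gaussianReal 0 v) μ) →
      (v : ℝ) ≤ σ ^ 2 →
      1 - 2 * (p : ℝ) ^ (-(c * (k : ℝ))) - 2 * (p : ℝ) ^ (-(c * ((k : ℝ) - d + 1))) ≤
        μ.real {ω |
          (c₀ * (((k : ℝ) - d + 1) * Real.log p) ≤ n →
            phiZero k d (secondMoment μ ε) (X ω) ≤
              Cstar * σ ^ 2 * (1 + C * √(((k : ℝ) - d + 1) * Real.log p / n))) ∧
          (c₀ * ((k : ℝ) * Real.log p) ≤ n →
            phiOne k (secondMoment μ ε) (X ω) ≤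
              Cmax * σ ^ 2 * (1 + C * √((k : ℝ) * Real.log p / n)) ∧
            ∀ p₀ : ℝ, 0 < p₀ → p₀ < 1 / 2 →
              Real.log (1 / p₀) ≤ A * ((k : ℝ) * Real.log (2 * Real.exp 1 * p * d / k)) →
              phiReg k d b p₀ (secondMoment μ ε) (X ω) ≤
                C' * σ * √(min ((d : ℝ) * Cstar) Cmax * ((k : ℝ) / n) *
                  Real.log (2 * Real.exp 1 * p * d / k)))} := by
  obtain ⟨C₀, hC₀, hconc⟩ := exists_design_concentration κ c₀ hc₀
  -- The factor 4 is the loss of the net argument for `φ₁`; `φ₀` would need only `C₀`.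
  refine ⟨1, 4 * C₀, one_pos, by positivity, fun b A hb hA => ?_⟩
  -- Uniform bound on both correction factors under the sample-size conditions.
  set M := 1 + 4 * C₀ / √c₀ with hM
  have hM0 : 0 < M := by positivity
  refine ⟨√(M * (1 + b * (1 + A))), Real.sqrt_pos.2 (by positivity), ?_⟩
  intro n p k d hn hd hdk hkp Cmax Cstar σ hCC hσ Ψ hΨ hΨmax hblock Ω _ μ _ X ε v hXind hXid _ hXcov
    hXψ hεind hεlaw hv
  rw [secondMoment_of_iIndepFun_gaussianReal hεind hεlaw]
  have hp1 : 1 ≤ p := by omega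
  have hn' : (0 : ℝ) < n := by exact_mod_cast hn
  have hp' : (0 : ℝ) < p := by exact_mod_cast hp1
  -- For `p = 1` the claimed lower bound is `1 - 2 - 2 < 0`.
  rcases hp1.eq_or_lt with rfl | hp2
  · refine le_trans ?_ measureReal_nonneg
    norm_num
  have hm : (k : ℝ) - d + 1 = ((k - d + 1 : ℕ) : ℝ) := by push_cast [hdk]; ring
  rw [hm]
  have hmk : k - d + 1 ≤ k := by omega
  have hmk' : ((k - d + 1 : ℕ) : ℝ) ≤ k := by exact_mod_cast hmk
  set m := k - d + 1 with hmdef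
  have hlogp : 0 ≤ Real.log p := Real.log_nonneg (by exact_mod_cast hp1)
  have hrpow : ∀ a : ℕ, (p : ℝ) ^ (-(1 * (a : ℝ))) = Real.exp (-(a * Real.log p)) := fun a => by
    rw [Real.rpow_def_of_pos hp']; ring_nf
  have hpow : ∀ a : ℕ, (p : ℝ) ^ a ≤ Real.exp (a * Real.log p) := fun a => by
    rw [Real.exp_nat_mul, Real.exp_log hp']
  have hconc' : ∀ a : ℕ, c₀ * (a * Real.log p) ≤ n → ∀ w : Fin p → ℝ,
      μ.real {ω | n * (C₀ * √(a * Real.log p / n)) * (w ⬝ᵥ Ψ *ᵥ w) <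
          |(X ω *ᵥ w) ⬝ᵥ (X ω *ᵥ w) - n * (w ⬝ᵥ Ψ *ᵥ w)|} ≤
        2 * Real.exp (-(8 * (a * Real.log p))) := by
    intro a ha w
    have h1 := hconc μ n p Ψ hΨ X (fun i => (hXid i i).aemeasurable_fst) hXind hXcov hXψ
      (a * Real.log p / n) (by positivity)
      (by rw [← mul_div_assoc]; exact (div_le_one hn').2 ha) w
    rwa [mul_div_cancel₀ _ hn'.ne'] at h1
  have hCstar : 0 ≤ Cstar :=
    (blockAverage_nonneg hΨ.posSemidef {⟨0, hp1⟩}).trans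
      (hblock _ (Finset.singleton_nonempty _) (by rw [Finset.card_singleton]; omega))
  have hCmax : 0 ≤ Cmax := hCstar.trans hCC
  obtain ⟨B₀, hB₀, hφ₀⟩ : ∃ B : Set Ω, μ.real B ≤ 2 * Real.exp (-(m * Real.log p)) ∧ ∀ ω ∉ B,
      c₀ * (m * Real.log p) ≤ n →
      phiZero k d ((v : ℝ) • (1 : Matrix (Fin n) (Fin n) ℝ)) (X ω) ≤
        Cstar * σ ^ 2 * (1 + 4 * C₀ * √(m * Real.log p / n)) := by
    -- If the sample-size condition fails, the implication is vacuous and the exceptional set is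
    -- taken empty.
    by_cases hcond : c₀ * (m * Real.log p) ≤ n
    · obtain ⟨B, hB, h⟩ := exists_event_phiZero_le (d := d) hn hCstar (by positivity) hv
        (fun J hJ hJc => hblock J hJ (hJc.trans hmk)) (hconc' m hcond) (by positivity) (hpow m)
      refine ⟨B, hB, fun ω hω _ => (h ω hω).trans ?_⟩
      gcongr
      linarith
    · exact ⟨∅, by simp; positivity, fun ω _ h => absurd h hcond⟩
  obtain ⟨B₁, hB₁, hφ₁⟩ : ∃ B : Set Ω, μ.real B ≤ 2 * Real.exp (-(k * Real.log p)) ∧ ∀ ω ∉ B,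
      c₀ * (k * Real.log p) ≤ n →
      phiOne k ((v : ℝ) • (1 : Matrix (Fin n) (Fin n) ℝ)) (X ω) ≤
        Cmax * σ ^ 2 * (1 + 4 * C₀ * √(k * Real.log p / n)) := by
    by_cases hcond : c₀ * (k * Real.log p) ≤ n
    · obtain ⟨B, hB, h⟩ := exists_event_phiOne_le (k := k) hn (by positivity) hv hΨmax
        (hconc' k hcond) hp2 (hpow k)
      refine ⟨B, hB, fun ω hω _ => (h ω hω).trans_eq ?_⟩
      ring
    · exact ⟨∅, by simp; positivity, fun ω _ h => absurd h hcond⟩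
  have hMle : ∀ a : ℕ, c₀ * (a * Real.log p) ≤ n → 1 + 4 * C₀ * √(a * Real.log p / n) ≤ M := by
    intro a ha
    have h1 : √(a * Real.log p / n) ≤ 1 / √c₀ := by
      rw [← Real.sqrt_one, ← Real.sqrt_div zero_le_one]
      refine Real.sqrt_le_sqrt ?_
      rw [div_le_div_iff₀ hn' hc₀]
      linarith
    rw [hM, div_eq_mul_one_div (4 * C₀)]
    gcongr
  have hgood : ∀ ω, ω ∉ B₀ ∪ B₁ → ω ∈ {ω |
          (c₀ * ((m : ℝ) * Real.log p) ≤ n →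
            phiZero k d ((v : ℝ) • (1 : Matrix (Fin n) (Fin n) ℝ)) (X ω) ≤
              Cstar * σ ^ 2 * (1 + 4 * C₀ * √((m : ℝ) * Real.log p / n))) ∧
          (c₀ * ((k : ℝ) * Real.log p) ≤ n →
            phiOne k ((v : ℝ) • (1 : Matrix (Fin n) (Fin n) ℝ)) (X ω) ≤
              Cmax * σ ^ 2 * (1 + 4 * C₀ * √((k : ℝ) * Real.log p / n)) ∧
            ∀ p₀ : ℝ, 0 < p₀ → p₀ < 1 / 2 →
              Real.log (1 / p₀) ≤ A * ((k : ℝ) * Real.log (2 * Real.exp 1 * p * d / k)) →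
              phiReg k d b p₀ ((v : ℝ) • (1 : Matrix (Fin n) (Fin n) ℝ)) (X ω) ≤
                √(M * (1 + b * (1 + A))) * σ * √(min ((d : ℝ) * Cstar) Cmax * ((k : ℝ) / n) *
                  Real.log (2 * Real.exp 1 * p * d / k)))} := by
    intro ω hω
    rw [Set.mem_union, not_or] at hω
    refine ⟨hφ₀ ω hω.1, fun hcond => ⟨hφ₁ ω hω.2 hcond, fun p₀ h1 h2 h3 => ?_⟩⟩
    have hcond' : c₀ * (m * Real.log p) ≤ n := le_trans (by gcongr) hcond
    refine phiReg_le hd hdk hkp (by linarith) hA.le hM0.le hσ hCstar hCC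
      ((hφ₀ ω hω.1 hcond').trans ?_) ((hφ₁ ω hω.2 hcond).trans ?_) h1 h2 h3
    · gcongr
      exact hMle m hcond'
    · gcongr
      exact hMle k hcond
  rw [hrpow, hrpow]
  set S := {ω | _}
  -- Covering the whole space replaces complementation, which would require measurable sets.
  have huniv : (Set.univ : Set Ω) ⊆ S ∪ (B₀ ∪ B₁) := fun ω _ => by
    by_cases h : ω ∈ B₀ ∪ B₁
    · exact Or.inr h
    · exact Or.inl (hgood ω h)
  have h1 : (1 : ℝ) ≤ μ.real (S ∪ (B₀ ∪ B₁)) := by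
    rw [← probReal_univ (μ := μ)]
    exact measureReal_mono huniv
  have h2 := measureReal_union_le (μ := μ) S (B₀ ∪ B₁)
  have h3 := measureReal_union_le (μ := μ) B₀ B₁
  linarith
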